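/- **Theorem 4.1.** For complex $a,q$ with $|q|<1$ put $(a;q)_n=\prod_{k=0}^{n-1}(1-aq^k)$ and $(a;q)_\infty=\prod_{k=0}^{\infty}(1-aq^k)$. Let the 2D $q$-Hermite polynomials be $$H_{m,n}(z_1,z_2\mid q)=(q;q)_m(q;q)_n\sum_{k=0}^{\min(m,n)}\frac{(-1)^kq^{\binom k2}\,z_1^{m-k}z_2^{n-k}}{(q;q)_{m-k}(q;q)_{n-k}(q;q)_k}\qquad(m,n\ge 0),$$ and for every integer $M$ let $\binom M2=M(M-1)/2$ (with $0^0=1$). Let $q,z_1,z_2,r,s\in\mathbb C$ with $|q|<1$, $|rz_1|<1$ and $|sz_2|<1$. Then $$\frac{2\,(rs;q)_\infty^2}{(z_1z_2rs;q)_\infty}=\sum\frac{H_{m_1,n_1}(z_1,z_2\mid q)\,H_{m_2,n_2}(z_1,z_2\mid q)}{(q;q)_{m_1}(q;q)_{m_2}(q;q)_{n_1}(q;q)_{n_2}}\,r^{m_1+m_2}s^{n_1+n_2}\,(-1)^M\left(q^{\binom M2}+q^{\binom{-M}2}\right),\qquad M=\frac{m_1+n_2-n_1-m_2}{2},$$ where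 the sum is over all integers $m_1,m_2,n_1,n_2\ge 0$ such that $m_1+m_2-n_1-n_2$ is even, and the series converges absolutely. -/

import Mathlib

/-- The finite `q`-shifted factorial `(a;q)_n = ∏_{k=0}^{n-1} (1 - a q^k)`. -/
noncomputable def qPoch (a q : ℂ) (n : ℕ) : ℂ :=
  ∏ k ∈ Finset.range n, (1 - a * q ^ k)

/-- The infinite `q`-shifted factorial `(a;q)_∞ = ∏_{k=0}^∞ (1 - a q^k)`
(the product converges when `‖q‖ < 1`). -/
noncomputable def qPochInf (a q : ℂ) : ℂ :=
  ∏' k : ℕ, (1 - a * q ^ k)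

/-- The 2D `q`-Hermite polynomial `H_{m,n}(z₁,z₂|q)`, given by
`H_{m,n} / ((q;q)_m (q;q)_n)
  = ∑_{k=0}^{min m n} (-1)^k q^{k(k-1)/2} z₁^{m-k} z₂^{n-k} / ((q;q)_{m-k} (q;q)_{n-k} (q;q)_k)`.
These are the polynomials with generating function
`∑ H_{m,n} u^m v^n / ((q;q)_m (q;q)_n) = (uv;q)_∞ / ((u z₁;q)_∞ (v z₂;q)_∞)`. -/
noncomputable def qHermite2D (q : ℂ) (m n : ℕ) (z₁ z₂ : ℂ) : ℂ :=
  qPoch q q m * qPoch q q n *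
    ∑ k ∈ Finset.range (min m n + 1),
      (-1) ^ k * q ^ (k.choose 2) * z₁ ^ (m - k) * z₂ ^ (n - k) /
        (qPoch q q (m - k) * qPoch q q (n - k) * qPoch q q k)

/-- The weight `(-1)^M (q^{C(M,2)} + q^{C(-M,2)})` for an integer `M`, where
`C(M,2) = M(M-1)/2` is the generalized binomial coefficient (a nonnegative integer). -/
noncomputable def qHermiteWeight (q : ℂ) (M : ℤ) : ℂ :=
  (-1) ^ M * (q ^ (Ring.choose M 2) + q ^ (Ring.choose (-M) 2))

/-- The term of the bilinear series with indices `m₁, m₂, n₁, n₂`; it is used only when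
`m₁ + m₂ - n₁ - n₂` is even, so that the division below is exact. -/
noncomputable def qHermiteTerm (q z₁ z₂ r s : ℂ) (m₁ m₂ n₁ n₂ : ℕ) : ℂ :=
  qHermite2D q m₁ n₁ z₁ z₂ * qHermite2D q m₂ n₂ z₁ z₂ /
      (qPoch q q m₁ * qPoch q q m₂ * qPoch q q n₁ * qPoch q q n₂) *
    r ^ (m₁ + m₂) * s ^ (n₁ + n₂) *
    qHermiteWeight q (((m₁ : ℤ) + n₂ - n₁ - m₂) / 2)

open Filter Topology

/-! Expanding both polynomials and substituting `mᵢ = aᵢ + kᵢ`, `nᵢ = bᵢ + kᵢ` changes neither `M`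
nor the parity condition. The series therefore splits into two Euler series for `(rs;q)_∞` times a
weighted series in `a = r z₁`, `b = s z₂` (`sum_collectFiber`, `hasSum_eulerTerm_mul_weightedTerm`).

Group the weighted series by `N = a₁ + a₂` and `P = b₁ + b₂`. A finite `q`-binomial sum
(`sum_antidiagonal_signedQPow`) annihilates every block with `N ≠ P` and leaves `2 (ab)^N / (q;q)_N`
on the diagonal, which Euler's identity sums to `2 / (ab;q)_∞`. Absolute convergence justifies all
regroupings. -/

/-! ### Shifted factorials: nonvanishing and limits. -/

theorem qPoch_zero (a q : ℂ) : qPoch a q 0 = 1 := by simp [qPoch]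

theorem qPoch_self_succ (q : ℂ) (n : ℕ) :
    qPoch q q (n + 1) = qPoch q q n * (1 - q ^ (n + 1)) := by
  rw [qPoch, Finset.prod_range_succ, ← qPoch, pow_succ']

theorem one_sub_pow_succ_ne_zero {q : ℂ} (hq : ‖q‖ < 1) (n : ℕ) : 1 - q ^ (n + 1) ≠ 0 := by
  intro h
  have h1 : ‖q ^ (n + 1)‖ = 1 := by rw [← sub_eq_zero.mp h, norm_one]
  rw [norm_pow] at h1
  exact (pow_lt_one₀ (norm_nonneg q) hq n.succ_ne_zero).ne h1

theorem qPoch_self_ne_zero {q : ℂ} (hq : ‖q‖ < 1) (n : ℕ) : qPoch q q n ≠ 0 := by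
  induction n with
  | zero => simp [qPoch_zero]
  | succ n ih =>
    rw [qPoch_self_succ]
    exact mul_ne_zero ih (one_sub_pow_succ_ne_zero hq n)

theorem one_sub_pow_div_qPoch_succ {q : ℂ} (hq : ‖q‖ < 1) (n : ℕ) :
    (1 - q ^ (n + 1)) / qPoch q q (n + 1) = 1 / qPoch q q n := by
  rw [qPoch_self_succ]
  have := one_sub_pow_succ_ne_zero hq n
  have := qPoch_self_ne_zero hq n
  field_simp

theorem tendsto_one_sub_pow_succ {q : ℂ} (hq : ‖q‖ < 1) :
    Tendsto (fun n : ℕ => 1 - q ^ (n + 1)) atTop (𝓝 1) := by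
  simpa using ((tendsto_pow_atTop_nhds_zero_of_norm_lt_one hq).comp
    (tendsto_add_atTop_nat 1)).const_sub 1

/-- The partial products of `(a;q)_∞` converge to it. -/
theorem tendsto_qPoch (a : ℂ) {q : ℂ} (hq : ‖q‖ < 1) :
    Tendsto (qPoch a q) atTop (𝓝 (qPochInf a q)) := by
  have hs : Summable fun k : ℕ => ‖-(a * q ^ k)‖ := by
    simpa [norm_mul, norm_pow] using
      (summable_geometric_of_lt_one (norm_nonneg q) hq).mul_left ‖a‖
  have := (multipliable_one_add_of_summable hs).tendsto_prod_tprod_nat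
  simp only [← sub_eq_add_neg] at this
  exact this

/-! ### Euler's two expansions. -/

/-- A power series in `x` with constant coefficient one tends to one along `x q ^ n`. -/
theorem tendsto_tsum_mul_pow {q x : ℂ} (hq : ‖q‖ < 1) {c : ℕ → ℂ} (hc : c 0 = 1)
    (hs : Summable fun k => ‖c k * x ^ k‖) :
    Tendsto (fun n : ℕ => ∑' k, c k * (x * q ^ n) ^ k) atTop (𝓝 1) := by
  have h1 : (1 : ℂ) = ∑' k : ℕ, if k = 0 then 1 else 0 := by simp
  rw [h1]
  refine tendsto_tsum_of_dominated_convergence hs (fun k => ?_) (Eventually.of_forall ?_)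
  · rcases k with _ | k
    · simp [hc]
    · have : Tendsto (fun n : ℕ => x * q ^ n) atTop (𝓝 0) := by
        simpa using (tendsto_pow_atTop_nhds_zero_of_norm_lt_one hq).const_mul x
      simpa using (this.pow (k + 1)).const_mul (c (k + 1))
  · intro n k
    rw [mul_pow, norm_mul, norm_mul, norm_mul]
    have : ‖(q ^ n) ^ k‖ ≤ 1 := by
      rw [norm_pow, norm_pow]
      exact pow_le_one₀ (by positivity) (pow_le_one₀ (norm_nonneg q) hq.le)
    exact mul_le_mul_of_nonneg_left (mul_le_of_le_one_right (norm_nonneg _) this) (norm_nonneg _)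

theorem summable_norm_pow_div_qPoch {q x : ℂ} (hq : ‖q‖ < 1) (hx : ‖x‖ < 1) :
    Summable fun n : ℕ => ‖1 / qPoch q q n * x ^ n‖ := by
  -- The term ratio `‖x‖ / ‖1 - q ^ (n + 1)‖` tends to `‖x‖`, so it is eventually below any such
  -- `ρ`.
  obtain ⟨ρ, hρ, hρ1⟩ := exists_between hx
  refine summable_of_ratio_norm_eventually_le hρ1 ?_
  have ht : Tendsto (fun n : ℕ => ρ * ‖1 - q ^ (n + 1)‖) atTop (𝓝 (ρ * ‖(1 : ℂ)‖)) :=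
    (tendsto_one_sub_pow_succ hq).norm.const_mul ρ
  rw [norm_one, mul_one] at ht
  filter_upwards [ht.eventually_const_lt hρ] with n hn
  rw [norm_norm, norm_norm, qPoch_self_succ]
  have h0 : 0 < ‖1 - q ^ (n + 1)‖ := norm_pos_iff.mpr (one_sub_pow_succ_ne_zero hq n)
  have h1 : 0 < ‖qPoch q q n‖ := norm_pos_iff.mpr (qPoch_self_ne_zero hq n)
  simp only [norm_mul, norm_div, norm_one, norm_pow] at *
  rw [pow_succ]
  calc 1 / (‖qPoch q q n‖ * ‖1 - q ^ (n + 1)‖) * (‖x‖ ^ n * ‖x‖)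
      = (1 / ‖qPoch q q n‖ * ‖x‖ ^ n) * (‖x‖ / ‖1 - q ^ (n + 1)‖) := by field_simp
    _ ≤ (1 / ‖qPoch q q n‖ * ‖x‖ ^ n) * ρ := by
        gcongr
        rw [div_le_iff₀ h0]
        exact hn.le
    _ = _ := by ring

theorem summable_norm_neg_one_pow_mul_qPow_div_qPoch {q : ℂ} (hq : ‖q‖ < 1) (x : ℂ) :
    Summable fun k : ℕ => ‖(-1) ^ k * q ^ (k.choose 2) / qPoch q q k * x ^ k‖ := by
  refine summable_of_ratio_norm_eventually_le (r := 1 / 2) (by norm_num) ?_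
  have ht : Tendsto (fun n : ℕ => ‖1 - q ^ (n + 1)‖ - 2 * (‖q ^ n‖ * ‖x‖)) atTop
      (𝓝 (‖(1 : ℂ)‖ - 2 * (‖(0 : ℂ)‖ * ‖x‖))) :=
    (tendsto_one_sub_pow_succ hq).norm.sub
      (((tendsto_pow_atTop_nhds_zero_of_norm_lt_one hq).norm.mul_const ‖x‖).const_mul 2)
  filter_upwards [ht.eventually_const_lt (u := 0) (by simp)] with n hn
  rw [norm_norm, norm_norm, qPoch_self_succ, Nat.choose_succ_succ' n 1, Nat.choose_one_right]
  have h0 : 0 < ‖1 - q ^ (n + 1)‖ := norm_pos_iff.mpr (one_sub_pow_succ_ne_zero hq n)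
  have h1 : 0 < ‖qPoch q q n‖ := norm_pos_iff.mpr (qPoch_self_ne_zero hq n)
  simp only [norm_mul, norm_div, norm_one, norm_pow, norm_neg, one_pow, one_mul] at *
  rw [pow_succ, pow_add]
  norm_num
  calc ‖q‖ ^ n * ‖q‖ ^ (n.choose 2) / (‖qPoch q q n‖ * ‖1 - q ^ (n + 1)‖) * (‖x‖ ^ n * ‖x‖)
      = (‖q‖ ^ (n.choose 2) / ‖qPoch q q n‖ * ‖x‖ ^ n) *
          (‖q‖ ^ n * ‖x‖ / ‖1 - q ^ (n + 1)‖) := by field_simp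
    _ ≤ (‖q‖ ^ (n.choose 2) / ‖qPoch q q n‖ * ‖x‖ ^ n) * (1 / 2) := by
        refine mul_le_mul_of_nonneg_left ?_ (by positivity)
        rw [div_le_iff₀ h0]
        linarith
    _ = _ := by ring

/-- Euler's identity `∑ xⁿ / (q;q)_n = 1 / (x;q)_∞`, in product form. -/
theorem tsum_pow_div_qPoch_mul_qPochInf {q x : ℂ} (hq : ‖q‖ < 1) (hx : ‖x‖ < 1) :
    (∑' n : ℕ, 1 / qPoch q q n * x ^ n) * qPochInf x q = 1 := by
  set G : ℂ → ℂ := fun y => ∑' n : ℕ, 1 / qPoch q q n * y ^ n with hG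
  -- Iterating this functional equation peels off the factors of `(x;q)_n`; the remaining `G (x * q
  -- ^ n)` tends to `G 0 = 1`.
  have hstep : ∀ y : ℂ, ‖y‖ < 1 → G y * (1 - y) = G (y * q) := by
    intro y hy
    have hy' : ‖y * q‖ < 1 := by
      rw [norm_mul]; exact mul_lt_one_of_nonneg_of_lt_one_left (norm_nonneg _) hy hq.le
    have s1 := (summable_norm_pow_div_qPoch hq hy).of_norm
    have s2 := (summable_norm_pow_div_qPoch hq hy').of_norm
    have h : G y - G (y * q) = y * G y := by
      simp only [hG]
      rw [← s1.tsum_sub s2, (s1.sub s2).tsum_eq_zero_add, ← tsum_mul_left]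
      simp only [pow_zero, mul_one, sub_self, zero_add]
      congr 1 with n
      have := one_sub_pow_div_qPoch_succ hq n
      linear_combination y ^ (n + 1) * this
    linear_combination h
  have hiter : ∀ n : ℕ, G x * qPoch x q n = G (x * q ^ n) := by
    intro n
    induction n with
    | zero => simp [qPoch_zero]
    | succ n ih =>
      have hn : ‖x * q ^ n‖ < 1 := by
        rw [norm_mul, norm_pow]
        exact mul_lt_one_of_nonneg_of_lt_one_left (norm_nonneg _) hx
          (pow_le_one₀ (norm_nonneg _) hq.le)
      rw [pow_succ, ← mul_assoc x, ← hstep _ hn, ← ih, qPoch, qPoch, Finset.prod_range_succ]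
      ring
  refine tendsto_nhds_unique ((tendsto_qPoch x hq).const_mul (G x)) ?_
  refine Tendsto.congr (fun n => (hiter n).symm) ?_
  exact tendsto_tsum_mul_pow hq (by simp [qPoch_zero]) (summable_norm_pow_div_qPoch hq hx)

/-- Euler's identity `∑ (-1)^k q^{k(k-1)/2} x^k / (q;q)_k = (x;q)_∞`. -/
theorem tsum_neg_one_pow_mul_qPow_div_qPoch {q : ℂ} (hq : ‖q‖ < 1) (x : ℂ) :
    ∑' k : ℕ, (-1) ^ k * q ^ (k.choose 2) / qPoch q q k * x ^ k = qPochInf x q := by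
  set F : ℂ → ℂ := fun y => ∑' k : ℕ, (-1) ^ k * q ^ (k.choose 2) / qPoch q q k * y ^ k with hF
  have hstep : ∀ y : ℂ, F y = (1 - y) * F (y * q) := by
    intro y
    have s1 := (summable_norm_neg_one_pow_mul_qPow_div_qPoch hq y).of_norm
    have s2 := (summable_norm_neg_one_pow_mul_qPow_div_qPoch hq (y * q)).of_norm
    have h : F y - F (y * q) = -y * F (y * q) := by
      simp only [hF]
      rw [← s1.tsum_sub s2, (s1.sub s2).tsum_eq_zero_add, ← tsum_mul_left]
      simp only [pow_zero, mul_one, sub_self, zero_add]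
      congr 1 with n
      have := one_sub_pow_div_qPoch_succ hq n
      rw [Nat.choose_succ_succ' n 1, Nat.choose_one_right, pow_add]
      linear_combination (-1) ^ (n + 1) * q ^ n * q ^ (n.choose 2) * y ^ (n + 1) * this
    linear_combination h
  have hiter : ∀ n : ℕ, F x = qPoch x q n * F (x * q ^ n) := by
    intro n
    induction n with
    | zero => simp [qPoch_zero]
    | succ n ih =>
      rw [ih, hstep, pow_succ, ← mul_assoc x, qPoch, qPoch, Finset.prod_range_succ]
      ring
  have h := (tendsto_qPoch x hq).mul (tendsto_tsum_mul_pow hq (by simp [qPoch_zero])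
    (summable_norm_neg_one_pow_mul_qPow_div_qPoch hq x))
  rw [mul_one] at h
  refine tendsto_nhds_unique (tendsto_const_nhds.congr fun n => ?_) h
  exact hiter n

/-! ### Signed powers and the weight. -/

/-- The signed power `(-1)^M q^{M(M-1)/2}` for an integer `M`. -/
noncomputable def signedQPow (q : ℂ) (M : ℤ) : ℂ :=
  (-1) ^ M * q ^ (Ring.choose M 2)

theorem qHermiteWeight_eq (q : ℂ) (M : ℤ) :
    qHermiteWeight q M = signedQPow q M + signedQPow q (-M) := by
  have : (-1 : ℂ) ^ (-M) = (-1) ^ M := by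
    rw [zpow_neg, ← inv_zpow]; norm_num
  rw [qHermiteWeight, signedQPow, signedQPow, this, mul_add]

theorem int_choose_two_succ (M : ℤ) : Ring.choose (M + 1) 2 = Ring.choose M 2 + M := by
  have := Ring.choose_succ_succ M 1
  rw [Ring.choose_one_right] at this
  rw [this, add_comm]

theorem two_mul_int_choose_two (M : ℤ) : 2 * Ring.choose M 2 = M * (M - 1) := by
  induction M using Int.induction_on with
  | zero => simp [Ring.choose_zero_succ ℤ 1]
  | succ n ih => rw [int_choose_two_succ]; linarith
  | pred n ih =>
    have := int_choose_two_succ (-(n : ℤ) - 1)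
    rw [sub_add_cancel] at this
    linarith

theorem int_choose_two_nonneg (M : ℤ) : 0 ≤ Ring.choose M 2 := by
  have h := two_mul_int_choose_two M
  have : 0 ≤ M * (M - 1) := by
    rcases le_or_gt M 0 with hM | hM
    · nlinarith
    · exact mul_nonneg hM.le (by omega)
  omega

theorem int_choose_two_one_sub (M : ℤ) : Ring.choose (1 - M) 2 = Ring.choose M 2 := by
  have h1 := two_mul_int_choose_two M
  have h2 := two_mul_int_choose_two (1 - M)
  linarith

theorem norm_signedQPow_le_one {q : ℂ} (hq : ‖q‖ ≤ 1) (M : ℤ) : ‖signedQPow q M‖ ≤ 1 := by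
  obtain ⟨a, ha⟩ := Int.eq_ofNat_of_zero_le (int_choose_two_nonneg M)
  rw [signedQPow, ha, norm_mul, norm_zpow, norm_neg, norm_one, one_zpow, one_mul, zpow_natCast,
    norm_pow]
  exact pow_le_one₀ (norm_nonneg q) hq

theorem norm_qHermiteWeight_le {q : ℂ} (hq : ‖q‖ ≤ 1) (M : ℤ) : ‖qHermiteWeight q M‖ ≤ 2 := by
  rw [qHermiteWeight_eq]
  refine (norm_add_le _ _).trans ?_
  linarith [norm_signedQPow_le_one hq M, norm_signedQPow_le_one hq (-M)]

/-- The exponent is invariant under `M ↦ 1 - M` while the sign flips. -/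
theorem signedQPow_one_sub (q : ℂ) (M : ℤ) : signedQPow q (1 - M) = -signedQPow q M := by
  have : (-1 : ℂ) ^ (1 - M) = -(-1) ^ M := by
    rw [zpow_sub₀ (by norm_num), zpow_one, div_eq_mul_inv, ← inv_zpow]; norm_num
  rw [signedQPow, signedQPow, int_choose_two_one_sub, this, neg_mul]

/-! ### Finite orthogonality sums. -/

theorem pow_mul_signedQPow_sub (q : ℂ) (i t : ℕ) :
    q ^ i * signedQPow q (i - t) = -(q ^ t * signedQPow q (i - t + 1)) := by
  have h := int_choose_two_succ (i - t)
  obtain ⟨a, ha⟩ := Int.eq_ofNat_of_zero_le (int_choose_two_nonneg ((i : ℤ) - t))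
  obtain ⟨b, hb⟩ := Int.eq_ofNat_of_zero_le (int_choose_two_nonneg ((i : ℤ) - t + 1))
  rw [signedQPow, signedQPow, ha, hb, zpow_natCast, zpow_natCast, zpow_add_one₀ (by norm_num)]
  have hab : i + a = t + b := by omega
  have hp : q ^ i * q ^ a = q ^ t * q ^ b := by rw [← pow_add, ← pow_add, hab]
  linear_combination (-1) ^ ((i : ℤ) - t) * hp

/-- For `i + j = n + 1`, write `1 - q^(n+1) = (1 - q^i) + q^i (1 - q^j)`. Each bracket cancels the
last factor of one denominator, and the second resulting sum is `-q^t` times the first. -/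
theorem one_sub_mul_sum_antidiagonal_signedQPow {q : ℂ} (hq : ‖q‖ < 1) (n t : ℕ) :
    (1 - q ^ (n + 1)) * ∑ p ∈ Finset.HasAntidiagonal.antidiagonal (n + 1),
        signedQPow q (p.1 - t) / (qPoch q q p.1 * qPoch q q p.2) =
      (1 - q ^ t) * ∑ p ∈ Finset.HasAntidiagonal.antidiagonal n,
        signedQPow q (p.1 - t + 1) / (qPoch q q p.1 * qPoch q q p.2) := by
  have hsplit : ∀ p ∈ Finset.HasAntidiagonal.antidiagonal (n + 1),
      (1 - q ^ (n + 1)) * (signedQPow q (p.1 - t) / (qPoch q q p.1 * qPoch q q p.2)) =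
        signedQPow q (p.1 - t) * ((1 - q ^ p.1) / qPoch q q p.1) / qPoch q q p.2 +
        q ^ p.1 * signedQPow q (p.1 - t) / qPoch q q p.1 * ((1 - q ^ p.2) / qPoch q q p.2) := by
    intro p hp
    rw [← Finset.HasAntidiagonal.mem_antidiagonal.mp hp, pow_add]
    have := qPoch_self_ne_zero hq p.1
    have := qPoch_self_ne_zero hq p.2
    field_simp
    ring
  rw [Finset.mul_sum, Finset.sum_congr rfl hsplit, Finset.sum_add_distrib,
    Finset.Nat.sum_antidiagonal_succ, Finset.Nat.sum_antidiagonal_succ', sub_mul, one_mul,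
    sub_eq_add_neg (∑ _ ∈ _, _) (_ * _), Finset.mul_sum, ← Finset.sum_neg_distrib]
  simp only [pow_zero, sub_self, zero_div, mul_zero, zero_add,
    one_sub_pow_div_qPoch_succ hq]
  congr 1
  · refine Finset.sum_congr rfl fun p _ => ?_
    rw [show ((p.1 + 1 : ℕ) : ℤ) - t = p.1 - t + 1 by push_cast; ring]
    field_simp
  · refine Finset.sum_congr rfl fun p _ => ?_
    rw [pow_mul_signedQPow_sub]
    field_simp

/-- A case of the finite `q`-binomial theorem. -/
theorem sum_antidiagonal_signedQPow {q : ℂ} (hq : ‖q‖ < 1) {n t : ℕ} (ht : t ≤ n) :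
    ∑ p ∈ Finset.HasAntidiagonal.antidiagonal n, signedQPow q (p.1 - t) / (qPoch q q p.1 * qPoch q q p.2) =
      if t = n then 1 else 0 := by
  induction n generalizing t with
  | zero =>
    obtain rfl : t = 0 := by omega
    simp [qPoch_zero, signedQPow, Ring.choose_zero_succ ℤ 1]
  | succ n ih =>
    have h := one_sub_mul_sum_antidiagonal_signedQPow hq n t
    have hn := one_sub_pow_succ_ne_zero hq n
    rcases t with _ | t
    · rw [pow_zero, sub_self, zero_mul] at h
      simpa [hn] using h
    · have h' := ih (t := t) (by omega)
      simp only [show ∀ i : ℕ, (i : ℤ) - (t + 1 : ℕ) + 1 = i - t by intro i; push_cast; ring,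
        h'] at h
      by_cases htn : t = n
      · subst htn
        rw [if_pos rfl] at h ⊢
        exact mul_left_cancel₀ hn h
      · rw [if_neg htn, mul_zero] at h
        rw [if_neg (by omega)]
        exact (mul_eq_zero.mp h).resolve_left hn

theorem sum_antidiagonal_antidiagonal_signedQPow {q : ℂ} (hq : ‖q‖ < 1) {N P : ℕ} {d : ℤ}
    (hd : (P : ℤ) - N = 2 * d) :
    ∑ i ∈ Finset.HasAntidiagonal.antidiagonal N, ∑ j ∈ Finset.HasAntidiagonal.antidiagonal P,
        signedQPow q (i.1 - j.1 + d) /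
          ((qPoch q q i.1 * qPoch q q i.2) * (qPoch q q j.1 * qPoch q q j.2)) =
      if N = P then 1 / qPoch q q N else 0 := by
  rcases lt_or_ge N P with h | h
  · rw [if_neg h.ne]
    refine Finset.sum_eq_zero fun i hi => ?_
    have hi' := Finset.HasAntidiagonal.mem_antidiagonal.mp hi
    -- Reflecting by `M ↦ 1 - M` makes the sum over `j` a `q`-binomial sum; `d ≥ 1` gives `0 ≤ t <
    -- P`, so it vanishes.
    obtain ⟨t, ht⟩ := Int.eq_ofNat_of_zero_le (a := i.1 + d - 1) (by omega)
    have h0 := sum_antidiagonal_signedQPow hq (n := P) (t := t) (by omega)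
    rw [if_neg (by omega)] at h0
    calc _ = ∑ j ∈ Finset.HasAntidiagonal.antidiagonal P, -(1 / (qPoch q q i.1 * qPoch q q i.2)) *
          (signedQPow q (j.1 - t) / (qPoch q q j.1 * qPoch q q j.2)) := by
          refine Finset.sum_congr rfl fun j _ => ?_
          rw [show (i.1 : ℤ) - j.1 + d = 1 - (j.1 - t) by omega, signedQPow_one_sub]
          field_simp
      _ = 0 := by rw [← Finset.mul_sum, h0, mul_zero]
  · rw [Finset.sum_comm]
    have hinner : ∀ j ∈ Finset.HasAntidiagonal.antidiagonal P, (∑ i ∈ Finset.HasAntidiagonal.antidiagonal N,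
        signedQPow q (i.1 - j.1 + d) /
          ((qPoch q q i.1 * qPoch q q i.2) * (qPoch q q j.1 * qPoch q q j.2))) =
        if N = P ∧ j = (P, 0) then 1 / qPoch q q N else 0 := by
      intro j hj
      have hj' := Finset.HasAntidiagonal.mem_antidiagonal.mp hj
      -- Here `d ≤ 0` and `t ≤ P - d = N + d ≤ N`, so `t = N` forces `d = 0` and `j = (P, 0)`.
      obtain ⟨t, ht⟩ := Int.eq_ofNat_of_zero_le (a := j.1 - d) (by omega)
      have h0 := sum_antidiagonal_signedQPow hq (n := N) (t := t) (by omega)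
      calc _ = ∑ i ∈ Finset.HasAntidiagonal.antidiagonal N, (1 / (qPoch q q j.1 * qPoch q q j.2)) *
            (signedQPow q (i.1 - t) / (qPoch q q i.1 * qPoch q q i.2)) := by
            refine Finset.sum_congr rfl fun i _ => ?_
            rw [show (i.1 : ℤ) - j.1 + d = i.1 - t by omega]
            field_simp
        _ = _ := by
            rw [← Finset.mul_sum, h0]
            by_cases hc : N = P ∧ j = (P, 0)
            · obtain ⟨rfl, rfl⟩ := hc
              rw [if_pos (by simp at ht; omega)]
              simp [qPoch_zero]
            · rw [if_neg hc, if_neg, mul_zero]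
              rintro rfl
              refine hc ⟨by omega, Prod.ext ?_ ?_⟩ <;> simp <;> omega
    rw [Finset.sum_congr rfl hinner]
    by_cases hNP : N = P
    · subst hNP
      simp
    · simp [hNP]

/-- The `q`-Hermite orthogonality relation in coefficient form. -/
theorem sum_antidiagonal_antidiagonal_qHermiteWeight {q : ℂ} (hq : ‖q‖ < 1) {N P : ℕ} {d : ℤ}
    (hd : (P : ℤ) - N = 2 * d) :
    ∑ i ∈ Finset.HasAntidiagonal.antidiagonal N, ∑ j ∈ Finset.HasAntidiagonal.antidiagonal P,
        qHermiteWeight q (i.1 - j.1 + d) /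
          ((qPoch q q i.1 * qPoch q q i.2) * (qPoch q q j.1 * qPoch q q j.2)) =
      if N = P then 2 / qPoch q q N else 0 := by
  have h1 := sum_antidiagonal_antidiagonal_signedQPow hq hd
  -- The `-M` half of the weight is the same sum with the two index pairs exchanged.
  have h2 := sum_antidiagonal_antidiagonal_signedQPow hq (N := P) (P := N) (d := -d) (by omega)
  rw [Finset.sum_comm] at h2
  have : (if N = P then 2 / qPoch q q N else 0) =
      (if N = P then 1 / qPoch q q N else 0) + (if P = N then 1 / qPoch q q P else 0) := by
    by_cases h : N = P
    · subst h; simp; ring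
    · simp [h, Ne.symm h]
  rw [this, ← h1, ← h2, ← Finset.sum_add_distrib]
  refine Finset.sum_congr rfl fun i _ => ?_
  rw [← Finset.sum_add_distrib]
  refine Finset.sum_congr rfl fun j _ => ?_
  rw [qHermiteWeight_eq, show -((i.1 : ℤ) - j.1 + d) = j.1 - i.1 + -d by ring, add_div,
    mul_comm (qPoch q q j.1 * qPoch q q j.2)]

/-! ### The weighted series. -/

theorem HasSum.sum_fiberwise {α β γ : Type*} [AddCommGroup α] [UniformSpace α]
    [IsUniformAddGroup α] [CompleteSpace α] [T2Space α] {f : β → α} {a : α} (hf : HasSum f a)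
    (g : β → γ) (s : γ → Finset β) (hs : ∀ b c, b ∈ s c ↔ g b = c) :
    HasSum (fun c => ∑ b ∈ s c, f b) a := by
  have h := hf.tsum_fiberwise g
  refine h.congr_fun fun c => ?_
  have hc : g ⁻¹' {c} = (s c : Set β) := by
    ext b
    simp [hs]
  rw [hc, Finset.tsum_subtype']

/-- The summand of the Askey–Wilson type series obtained after removing the finite sums. -/
noncomputable def weightedTerm (q a b : ℂ) (x : (ℕ × ℕ) × ℕ × ℕ) : ℂ :=
  if Even ((x.1.1 + x.1.2 : ℤ) - x.2.1 - x.2.2) then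
    (1 / qPoch q q x.1.1 * a ^ x.1.1) * (1 / qPoch q q x.1.2 * a ^ x.1.2) *
      ((1 / qPoch q q x.2.1 * b ^ x.2.1) * (1 / qPoch q q x.2.2 * b ^ x.2.2)) *
      qHermiteWeight q (((x.1.1 : ℤ) + x.2.2 - x.2.1 - x.1.2) / 2)
  else 0

theorem summable_norm_weightedTerm {q a b : ℂ} (hq : ‖q‖ < 1) (ha : ‖a‖ < 1) (hb : ‖b‖ < 1) :
    Summable fun x => ‖weightedTerm q a b x‖ := by
  have sa := summable_norm_pow_div_qPoch hq ha
  have sb := summable_norm_pow_div_qPoch hq hb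
  refine Summable.of_nonneg_of_le (fun _ => norm_nonneg _) (fun x => ?_)
    (((sa.mul_norm sa).mul_norm (sb.mul_norm sb)).mul_right 2)
  unfold weightedTerm
  split_ifs with h
  · rw [norm_mul]
    exact mul_le_mul_of_nonneg_left (norm_qHermiteWeight_le hq.le _) (norm_nonneg _)
  · rw [norm_zero]
    positivity

theorem sum_antidiagonal_weightedTerm {q : ℂ} (hq : ‖q‖ < 1) (a b : ℂ) (N P : ℕ) :
    ∑ x ∈ Finset.HasAntidiagonal.antidiagonal N ×ˢ Finset.HasAntidiagonal.antidiagonal P, weightedTerm q a b x =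
      if N = P then 2 * (1 / qPoch q q N * (a * b) ^ N) else 0 := by
  by_cases hE : Even ((N : ℤ) - P)
  · obtain ⟨d, hd⟩ := hE
    have h := sum_antidiagonal_antidiagonal_qHermiteWeight hq (N := N) (P := P) (d := -d)
      (by omega)
    calc _ = a ^ N * b ^ P * ∑ i ∈ Finset.HasAntidiagonal.antidiagonal N, ∑ j ∈ Finset.HasAntidiagonal.antidiagonal P,
          qHermiteWeight q (i.1 - j.1 + -d) /
            ((qPoch q q i.1 * qPoch q q i.2) * (qPoch q q j.1 * qPoch q q j.2)) := by
          rw [Finset.sum_product, Finset.mul_sum]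
          refine Finset.sum_congr rfl fun i hi => ?_
          rw [Finset.mul_sum]
          refine Finset.sum_congr rfl fun j hj => ?_
          have hi' := Finset.HasAntidiagonal.mem_antidiagonal.mp hi
          have hj' := Finset.HasAntidiagonal.mem_antidiagonal.mp hj
          rw [weightedTerm, if_pos ⟨d, by simp only; omega⟩,
            show ((i.1 : ℤ) + j.2 - j.1 - i.2) / 2 = i.1 - j.1 + -d by omega, ← hi', ← hj',
            pow_add, pow_add]
          field_simp
      _ = _ := by
          rw [h]
          by_cases hNP : N = P
          · subst hNP
            simp only [if_true, mul_pow]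
            ring
          · simp [hNP]
  · have hNP : N ≠ P := by rintro rfl; simp at hE
    rw [if_neg hNP]
    refine Finset.sum_eq_zero fun x hx => ?_
    obtain ⟨hi, hj⟩ := Finset.mem_product.mp hx
    have hi' := Finset.HasAntidiagonal.mem_antidiagonal.mp hi
    have hj' := Finset.HasAntidiagonal.mem_antidiagonal.mp hj
    refine if_neg fun hc => hE ?_
    convert hc using 1
    omega

theorem hasSum_weightedTerm {q a b : ℂ} (hq : ‖q‖ < 1) (ha : ‖a‖ < 1) (hb : ‖b‖ < 1) :
    HasSum (weightedTerm q a b) (2 / qPochInf (a * b) q) := by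
  have hs := (summable_norm_weightedTerm hq ha hb).of_norm.hasSum
  have hab : ‖a * b‖ < 1 := by
    rw [norm_mul]; exact mul_lt_one_of_nonneg_of_lt_one_left (norm_nonneg _) ha hb.le
  have hf := hs.sum_fiberwise (fun x => (x.1.1 + x.1.2, x.2.1 + x.2.2))
    (fun c : ℕ × ℕ => Finset.HasAntidiagonal.antidiagonal c.1 ×ˢ Finset.HasAntidiagonal.antidiagonal c.2)
    (fun x c => by simp [Prod.ext_iff])
  simp only [sum_antidiagonal_weightedTerm hq] at hf
  have hinj : Function.Injective fun N : ℕ => (N, N) := fun _ _ h => congrArg Prod.fst h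
  rw [← hinj.hasSum_iff] at hf
  · simp only [Function.comp_def, if_true] at hf
    have h2 := (summable_norm_pow_div_qPoch hq hab).of_norm.hasSum.mul_left 2
    have he := hf.unique h2
    have hE := tsum_pow_div_qPoch_mul_qPochInf hq hab
    -- Euler's product being `1` also supplies `(ab;q)_∞ ≠ 0`.
    rw [he, eq_div_iff_mul_eq (right_ne_zero_of_mul_eq_one hE) |>.mpr hE] at hs
    rwa [mul_one_div] at hs
  · rintro ⟨N, P⟩ h
    exact if_neg fun hNP => h ⟨N, by simp_all⟩

/-! ### Reassembling the bilinear series. -/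

/-- The coefficient sequence of Euler's expansion of `(x;q)_∞`, with the power of `x`. -/
noncomputable def eulerTerm (q x : ℂ) (k : ℕ) : ℂ :=
  (-1) ^ k * q ^ (k.choose 2) / qPoch q q k * x ^ k

theorem hasSum_eulerTerm_mul_weightedTerm {q a b : ℂ} (hq : ‖q‖ < 1) (ha : ‖a‖ < 1)
    (hb : ‖b‖ < 1) (x : ℂ) :
    HasSum (fun y : (ℕ × ℕ) × (ℕ × ℕ) × ℕ × ℕ =>
        eulerTerm q x y.1.1 * eulerTerm q x y.1.2 * weightedTerm q a b y.2)
      (qPochInf x q * qPochInf x q * (2 / qPochInf (a * b) q)) := by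
  have se : Summable fun k => ‖eulerTerm q x k‖ :=
    summable_norm_neg_one_pow_mul_qPow_div_qPoch hq x
  have he : HasSum (eulerTerm q x) (qPochInf x q) := by
    rw [← tsum_neg_one_pow_mul_qPow_div_qPoch hq x]
    exact se.of_norm.hasSum
  have hee := he.mul he (summable_mul_of_summable_norm se se)
  have hsum := summable_mul_of_summable_norm
    (f := fun k : ℕ × ℕ => eulerTerm q x k.1 * eulerTerm q x k.2) (g := weightedTerm q a b)
    (se.mul_norm se) (summable_norm_weightedTerm hq ha hb)
  exact hee.mul (hasSum_weightedTerm hq ha hb) hsum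

theorem qHermite2D_div {q : ℂ} (hq : ‖q‖ < 1) (m n : ℕ) (z₁ z₂ : ℂ) :
    qHermite2D q m n z₁ z₂ / (qPoch q q m * qPoch q q n) =
      ∑ k ∈ Finset.range (min m n + 1), (-1) ^ k * q ^ (k.choose 2) / qPoch q q k *
        (1 / qPoch q q (m - k) * z₁ ^ (m - k)) * (1 / qPoch q q (n - k) * z₂ ^ (n - k)) := by
  rw [qHermite2D, mul_div_cancel_left₀ _
    (mul_ne_zero (qPoch_self_ne_zero hq m) (qPoch_self_ne_zero hq n))]
  refine Finset.sum_congr rfl fun k _ => ?_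
  field_simp

/-- The index map collecting the exponents of the product of two generating functions. -/
def collect (y : (ℕ × ℕ) × (ℕ × ℕ) × ℕ × ℕ) : ℕ × ℕ × ℕ × ℕ :=
  (y.2.1.1 + y.1.1, y.2.1.2 + y.1.2, y.2.2.1 + y.1.1, y.2.2.2 + y.1.2)

/-- The indices collected into `p`. -/
def collectFiber (p : ℕ × ℕ × ℕ × ℕ) : Finset ((ℕ × ℕ) × (ℕ × ℕ) × ℕ × ℕ) :=
  (Finset.range (min p.1 p.2.2.1 + 1) ×ˢ Finset.range (min p.2.1 p.2.2.2 + 1)).image fun k =>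
    (k, (p.1 - k.1, p.2.1 - k.2), p.2.2.1 - k.1, p.2.2.2 - k.2)

theorem mem_collectFiber (y : (ℕ × ℕ) × (ℕ × ℕ) × ℕ × ℕ) (p : ℕ × ℕ × ℕ × ℕ) :
    y ∈ collectFiber p ↔ collect y = p := by
  obtain ⟨⟨k, l⟩, ⟨a₁, a₂⟩, b₁, b₂⟩ := y
  obtain ⟨m₁, m₂, n₁, n₂⟩ := p
  simp only [collectFiber, collect, Finset.mem_image, Finset.mem_product, Finset.mem_range,
    Prod.mk.injEq, Prod.exists]
  constructor
  · rintro ⟨k', l', h, ⟨rfl, rfl⟩, ⟨h1, h2⟩, h3, h4⟩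
    omega
  · rintro ⟨h1, h2, h3, h4⟩
    exact ⟨k, l, by omega, ⟨rfl, rfl⟩, by omega, by omega, by omega⟩

theorem sum_collectFiber {q : ℂ} (hq : ‖q‖ < 1) (z₁ z₂ r s : ℂ) (p : ℕ × ℕ × ℕ × ℕ) :
    ∑ y ∈ collectFiber p, eulerTerm q (r * s) y.1.1 * eulerTerm q (r * s) y.1.2 *
        weightedTerm q (r * z₁) (s * z₂) y.2 =
      {p : ℕ × ℕ × ℕ × ℕ | Even ((p.1 : ℤ) + p.2.1 - p.2.2.1 - p.2.2.2)}.indicator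
        (fun p => qHermiteTerm q z₁ z₂ r s p.1 p.2.1 p.2.2.1 p.2.2.2) p := by
  obtain ⟨m₁, m₂, n₁, n₂⟩ := p
  rw [collectFiber, Finset.sum_image fun x _ y _ h => congrArg Prod.fst h]
  simp only [Set.indicator_apply, Set.mem_ofPred_eq]
  split_ifs with hE
  · rw [qHermiteTerm, show qPoch q q m₁ * qPoch q q m₂ * qPoch q q n₁ * qPoch q q n₂ =
        (qPoch q q m₁ * qPoch q q n₁) * (qPoch q q m₂ * qPoch q q n₂) by ring,
      mul_div_mul_comm, qHermite2D_div hq, qHermite2D_div hq, Finset.sum_mul_sum,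
      ← Finset.sum_product', Finset.sum_mul, Finset.sum_mul, Finset.sum_mul]
    refine Finset.sum_congr rfl fun k hk => ?_
    obtain ⟨k, l⟩ := k
    simp only [Finset.mem_product, Finset.mem_range] at hk
    obtain ⟨a₁, rfl⟩ := Nat.exists_eq_add_of_le (show k ≤ m₁ by omega)
    obtain ⟨a₂, rfl⟩ := Nat.exists_eq_add_of_le (show l ≤ m₂ by omega)
    obtain ⟨b₁, rfl⟩ := Nat.exists_eq_add_of_le (show k ≤ n₁ by omega)
    obtain ⟨b₂, rfl⟩ := Nat.exists_eq_add_of_le (show l ≤ n₂ by omega)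
    simp only [Nat.add_sub_cancel_left, weightedTerm, eulerTerm]
    -- The shifts `k` and `l` cancel in both the parity condition and `M`.
    rw [if_pos (by convert hE using 1; push_cast; ring)]
    rw [show ((k + a₁ : ℕ) : ℤ) + (l + b₂ : ℕ) - (k + b₁ : ℕ) - (l + a₂ : ℕ) =
      a₁ + b₂ - b₁ - a₂ by push_cast; ring]
    simp only [mul_pow, pow_add]
    ring
  · refine Finset.sum_eq_zero fun k hk => ?_
    obtain ⟨k, l⟩ := k
    simp only [Finset.mem_product, Finset.mem_range] at hk
    rw [weightedTerm, if_neg, mul_zero]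
    convert hE using 2
    simp only
    omega

theorem theorem4p1 (q z₁ z₂ r s : ℂ) (hq : ‖q‖ < 1)
    (h₁ : ‖r * z₁‖ < 1) (h₂ : ‖s * z₂‖ < 1) :
    HasSum
      (fun p : {p : ℕ × ℕ × ℕ × ℕ //
          Even ((p.1 : ℤ) + p.2.1 - p.2.2.1 - p.2.2.2)} =>
        qHermiteTerm q z₁ z₂ r s p.1.1 p.1.2.1 p.1.2.2.1 p.1.2.2.2)
      (2 * (qPochInf (r * s) q * qPochInf (r * s) q) / qPochInf (z₁ * z₂ * r * s) q) := by
  have h := (hasSum_eulerTerm_mul_weightedTerm hq h₁ h₂ (r * s)).sum_fiberwise collect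
    collectFiber mem_collectFiber
  simp only [sum_collectFiber hq] at h
  rw [show z₁ * z₂ * r * s = r * z₁ * (s * z₂) by ring, mul_comm 2, mul_div_assoc]
  exact hasSum_subtype_iff_indicator.mpr h
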